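/- **Setting.** Write $\mathbb N=\{1,2,\dots\}$ and $\mathbb Z[0,N)=\{0,\dots,N-1\}$. For $1\le p\le\infty$ and $N\in\mathbb N$ let $L_p^N$ be the space of functions $f:\mathbb Z[0,N)\to\mathbb R$ with norm $\|f\|_{L_p^N}=\big(\frac1N\sum_{i<N}|f(i)|^p\big)^{1/p}$ (for $p=\infty$: $\max_i|f(i)|$), let $\mathcal B(L_p^N)$ be its closed unit ball, and let $J_{p,\infty}^N:L_p^N\to L_\infty^N$ be the identity operator. Let $D,K$ be nonempty sets, let $F$ be a nonempty set of functions $D\to K$, $G$ a normed space and $S:F\to G$. A quantum query is a tuple $Q=(m,m',m'',Z,\tau,\beta)$ with $m,m',m''\in\mathbb N$, $m'+m''\le m$, $\emptyset\ne Z\subseteq\mathbb Z[0,2^{m'})$, $\tau:Z\to D$ and $\beta:K\to\mathbb Z[0,2^{m''})$. For $f\in F$, $Q_f$ is the unitary operator on the space of $m$ qubits (identified with $\mathbb C^{2^m}$) that maps a basis vector $|i\rangle|x\rangle|y\rangle$ (registers of $m'$, $m''$ and $m-m'-m''$ qubits) to $|i\rangle|x\oplus\beta(f(\tau(i)))\rangle|y\rangle$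 if $i\in Z$, where $\oplus$ is addition modulo $2^{m''}$, and to itself otherwise. A quantum algorithm without measurement consists of a query $Q$ and unitaries $U_0,\dots,U_r$ on the $m$-qubit space ($r\ge0$); it uses $r$ queries, and $A_f=U_rQ_fU_{r-1}\cdots U_1Q_fU_0$. A quantum algorithm $A$ from $F$ to $G$ consists of $k\ge1$ algorithms $A_0,\dots,A_{k-1}$ without measurement, where $A_l$ acts on $m_l$ qubits, of maps $b_l:\prod_{i<l}\mathbb Z[0,2^{m_i})\to\mathbb Z[0,2^{m_l})$ giving the initial basis state of $A_l$ in terms of the earlier measurement outcomes, and of an output map $\varphi:\prod_{l<k}\mathbb Z[0,2^{m_l})\to G$. At input $f$ the outcome sequence $(x_0,\dots,x_{k-1})$ has probability $\prod_{l<k}|\langle x_l|A_{l,f}|b_l(x_0,\dots,x_{l-1})\rangle|^2$, and $A$ outputs $\zeta=\varphi(x_0,\dots,x_{k-1})$. The number $n_q(A)$ of queries of $A$ is the sum of those of the $A_l$. The error of $A$ at $f$ is $e(S,A,f)=\inf\{\varepsilon\ge0:\mathbf P\{\|S(f)-\zeta\|>\varepsilon\}\le 1/4\}$, and the $n$-th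 minimal query error is $$e_n^{q}(S,F)=\inf_{A:\,n_q(A)\le n}\ \sup_{f\in F}e(S,A,f)\in[0,\infty].$$ **Proposition 3.** Let $1\le p\le\infty$. There are constants $c_1,c_2>0$ (which may depend on $p$) such that for all $n,N\in\mathbb N$ with $n\le c_1N$, $$e_n^{q}\big(J_{p,\infty}^N,\mathcal B(L_p^N)\big)\ \ge\ c_2\,\min\left(\left(\frac Nn\right)^{2/p},\,N^{1/p}\right),$$ where $J_{p,\infty}^N$ is restricted to the ball and $2/\infty=1/\infty=0$. -/

import Mathlib

open scoped ENNReal NNReal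

noncomputable section

namespace QIBC

/-! ### Quantum queries and quantum algorithms

The space of `m` qubits is `ℂ ^ (2 ^ m)`, with its canonical basis indexed by `Fin (2 ^ m)`;
a unitary operator is given by its matrix in this basis. -/

/-- A quantum query `(m, m', m'', Z, τ, β)` on functions `D → K`. Here `m1`, `m2` are the numbers
`m'`, `m''`. -/
structure Query (D K : Type*) where
  m : ℕ
  m1 : ℕ
  m2 : ℕ
  m_pos : 1 ≤ m
  m1_pos : 1 ≤ m1
  m2_pos : 1 ≤ m2
  le : m1 + m2 ≤ m
  Z : Set (Fin (2 ^ m1))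
  Z_nonempty : Z.Nonempty
  τ : Z → D
  β : K → Fin (2 ^ m2)

namespace Query

variable {D K : Type*}

lemma pow_split (Q : Query D K) :
    2 ^ Q.m1 * (2 ^ Q.m2 * 2 ^ (Q.m - Q.m1 - Q.m2)) = 2 ^ Q.m := by
  rw [← pow_add, ← pow_add]
  congr 1
  have := Q.le
  omega

/-- The splitting of the basis of `m` qubits into `|i⟩|x⟩|y⟩`, with `i` given by the `m'` leading
binary digits, `x` by the next `m''` digits and `y` by the remaining ones. -/
def split (Q : Query D K) :
    Fin (2 ^ Q.m1) × Fin (2 ^ Q.m2) × Fin (2 ^ (Q.m - Q.m1 - Q.m2)) ≃ Fin (2 ^ Q.m) :=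
  ((Equiv.refl _).prodCongr finProdFinEquiv).trans (finProdFinEquiv.trans (finCongr Q.pow_split))

open Classical in
/-- The number that is added (modulo `2 ^ m''`) to the second register when the first one
holds `i`. -/
def shift (Q : Query D K) (f : D → K) (i : Fin (2 ^ Q.m1)) : Fin (2 ^ Q.m2) :=
  if h : i ∈ Q.Z then Q.β (f (Q.τ ⟨i, h⟩)) else 0

/-- `|i⟩|x⟩|y⟩ ↦ |i⟩|x ⊕ β(f(τ(i)))⟩|y⟩` if `i ∈ Z`, and the identity otherwise. -/
def permTriple (Q : Query D K) (f : D → K) :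
    Equiv.Perm (Fin (2 ^ Q.m1) × Fin (2 ^ Q.m2) × Fin (2 ^ (Q.m - Q.m1 - Q.m2))) where
  toFun t := (t.1, t.2.1 + Q.shift f t.1, t.2.2)
  invFun t := (t.1, t.2.1 - Q.shift f t.1, t.2.2)
  left_inv t := by simp
  right_inv t := by simp

/-- The permutation of the canonical basis that defines `Q_f`. -/
def perm (Q : Query D K) (f : D → K) : Equiv.Perm (Fin (2 ^ Q.m)) :=
  (Q.split.symm.trans (Q.permTriple f)).trans Q.split

end Query

/-- The matrix of the operator that maps the basis vector `|b⟩` to `|g b⟩`. -/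
def basisMap {ι : Type*} [DecidableEq ι] (g : Equiv.Perm ι) : Matrix ι ι ℂ :=
  Matrix.of fun a b => if a = g b then 1 else 0

lemma basisMap_mem {ι : Type*} [Fintype ι] [DecidableEq ι] (g : Equiv.Perm ι) :
    basisMap g ∈ Matrix.unitaryGroup ι ℂ := by
  rw [Matrix.mem_unitaryGroup_iff']
  ext a b
  simp [basisMap, Matrix.mul_apply, Matrix.star_apply, Matrix.one_apply, eq_comm]

/-- The unitary operator `Q_f`. -/
def Query.op {D K : Type*} (Q : Query D K) (f : D → K) :
    Matrix.unitaryGroup (Fin (2 ^ Q.m)) ℂ :=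
  ⟨basisMap (Q.perm f), basisMap_mem _⟩

/-- A quantum algorithm with no measurement, `(Q, (U_j)_{j=0}^n)`. -/
structure PreAlgorithm (D K : Type*) where
  Q : Query D K
  n : ℕ
  U : Fin (n + 1) → Matrix.unitaryGroup (Fin (2 ^ Q.m)) ℂ

/-- `A_f = U_n Q_f U_{n-1} ⋯ U_1 Q_f U_0`. -/
def PreAlgorithm.op {D K : Type*} (A : PreAlgorithm D K) (f : D → K) :
    Matrix.unitaryGroup (Fin (2 ^ A.Q.m)) ℂ :=
  Fin.induction (motive := fun _ => Matrix.unitaryGroup (Fin (2 ^ A.Q.m)) ℂ)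
    (A.U 0) (fun j B => A.U j.succ * A.Q.op f * B) (Fin.last A.n)

/-- A quantum algorithm with `k ≥ 1` measurements and outputs in `G`. The initial basis state `b l`
of the `l`-th part is a function of the outcomes of all previous measurements. -/
structure Algorithm (D K G : Type*) where
  k : ℕ
  k_pos : 1 ≤ k
  A : Fin k → PreAlgorithm D K
  b : (l : Fin k) → ((i : {i : Fin k // i < l}) → Fin (2 ^ (A i).Q.m)) → Fin (2 ^ (A l).Q.m)
  φ : ((l : Fin k) → Fin (2 ^ (A l).Q.m)) → G

namespace Algorithm

variable {D K G : Type*}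

/-- The number of queries `n_q(A)`. -/
def numQueries (A : Algorithm D K G) : ℕ := ∑ l, (A.A l).n

/-- The probability `p_{A,f}(x_0, …, x_{k-1})` of the sequence `x` of measurement outcomes. -/
def outcomeProb (A : Algorithm D K G) (f : D → K) (x : (l : Fin A.k) → Fin (2 ^ (A.A l).Q.m)) : ℝ :=
  ∏ l, ‖((A.A l).op f).1 (x l) (A.b l fun i => x i)‖ ^ 2

open Classical in
/-- The output distribution: `A.outputProb f C` is the probability `A(f)(C)` that the output
of `A` at input `f` lies in `C`. -/
def outputProb (A : Algorithm D K G) (f : D → K) (C : Set G) : ℝ :=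
  ∑ x, if A.φ x ∈ C then A.outcomeProb f x else 0

end Algorithm

section Error

variable {D K G : Type*} [NormedAddCommGroup G] {F : Set (D → K)}

/-- `e(S, A, f, θ)`. -/
def errorAt (S : F → G) (A : Algorithm D K G) (f : F) (θ : ℝ) : ℝ≥0∞ :=
  ⨅ (ε : ℝ≥0) (_ : A.outputProb f {g | (ε : ℝ) < ‖S f - g‖} ≤ θ), (ε : ℝ≥0∞)

/-- `e(S, A, F, θ)`, the worst case error over `F`. -/
def errorOn (S : F → G) (A : Algorithm D K G) (θ : ℝ) : ℝ≥0∞ :=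
  ⨆ f : F, errorAt S A f θ

/-- `e_n^q(S, F, θ)`. -/
def minErrorWith (n : ℕ) (S : F → G) (θ : ℝ) : ℝ≥0∞ :=
  ⨅ (A : Algorithm D K G) (_ : A.numQueries ≤ n), errorOn S A θ

/-- The `n`-th minimal query error `e_n^q(S, F)`. -/
def minError (n : ℕ) (S : F → G) : ℝ≥0∞ :=
  minErrorWith n S (1 / 4)

end Error

/-! ### The spaces `L_p^N` -/

/-- `L_p^N`: the functions `{0, …, N - 1} → ℝ` with the `L_p` norm of the uniform probability
measure. -/
def LpN (_p : ℝ≥0∞) (N : ℕ) : Type := Fin N → ℝ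

namespace LpN

variable {p : ℝ≥0∞} {N : ℕ}

instance : AddCommGroup (LpN p N) := inferInstanceAs (AddCommGroup (Fin N → ℝ))

instance : Module ℝ (LpN p N) := inferInstanceAs (Module ℝ (Fin N → ℝ))

/-- The elements of `L_p^N` are the functions `{0, …, N - 1} → ℝ`. -/
def equiv (p : ℝ≥0∞) (N : ℕ) : LpN p N ≃ₗ[ℝ] (Fin N → ℝ) := LinearEquiv.refl ℝ (Fin N → ℝ)

/-- The `L_p^N` norm. -/
def lpNorm (p : ℝ≥0∞) (f : Fin N → ℝ) : ℝ :=
  if p = ∞ then ⨆ i, |f i|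
  else ((1 / (N : ℝ)) * ∑ i, |f i| ^ p.toReal) ^ (1 / p.toReal)

lemma lpNorm_eq [Fact (1 ≤ p)] (f : Fin N → ℝ) :
    lpNorm p f = (1 / (N : ℝ)) ^ (1 / p.toReal) * ‖WithLp.toLp p f‖ := by
  by_cases hp : p = ∞
  · subst hp
    simp [lpNorm, PiLp.norm_eq_ciSup]
  · have h1 : (1 : ℝ≥0∞) ≤ p := Fact.out
    have hpos : 0 < p.toReal := ENNReal.toReal_pos (by rintro rfl; simp at h1) hp
    rw [lpNorm, if_neg hp, PiLp.norm_eq_sum hpos, Real.mul_rpow (by positivity)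
      (Finset.sum_nonneg fun i _ => by positivity)]
    simp

lemma one_div_rpow_pos_or (p : ℝ≥0∞) (f : Fin N → ℝ) :
    0 < (1 / (N : ℝ)) ^ (1 / p.toReal) ∨ f = 0 := by
  rcases Nat.eq_zero_or_pos N with rfl | h
  · exact Or.inr (Subsingleton.elim _ _)
  · left
    positivity

instance [Fact (1 ≤ p)] : NormedAddCommGroup (LpN p N) :=
  AddGroupNorm.toNormedAddCommGroup
    { toFun := fun f => lpNorm p (equiv p N f)
      map_zero' := by simp [lpNorm_eq]
      add_le' := fun f g => by
        simp only [lpNorm_eq, map_add, WithLp.toLp_add, ← mul_add]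
        exact mul_le_mul_of_nonneg_left (norm_add_le _ _) (by positivity)
      neg' := fun f => by
        simp only [lpNorm_eq, map_neg, WithLp.toLp_neg, norm_neg]
      eq_zero_of_map_eq_zero' := fun f hf => by
        rcases one_div_rpow_pos_or p (equiv p N f) with h | h
        · rw [lpNorm_eq, mul_eq_zero, norm_eq_zero, WithLp.toLp_eq_zero] at hf
          exact (equiv p N).map_eq_zero_iff.1 (hf.resolve_left h.ne')
        · exact (equiv p N).map_eq_zero_iff.1 h }

lemma norm_def [Fact (1 ≤ p)] (f : LpN p N) : ‖f‖ = lpNorm p (equiv p N f) := rfl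

instance [Fact (1 ≤ p)] : NormedSpace ℝ (LpN p N) where
  norm_smul_le c f := by
    simp only [norm_def, lpNorm_eq, map_smul, WithLp.toLp_smul, norm_smul]
    exact le_of_eq (by ring)

end LpN

/-- The unit ball `B(L_p^N)`, as a set of functions `{0, …, N - 1} → ℝ`. -/
def unitBall (p : ℝ≥0∞) [Fact (1 ≤ p)] (N : ℕ) : Set (Fin N → ℝ) :=
  {f | ‖(LpN.equiv p N).symm f‖ ≤ 1}

/-- The identity operator `J_{pq}^N : L_p^N → L_q^N`. -/
def J (p q : ℝ≥0∞) (N : ℕ) : LpN p N →ₗ[ℝ] LpN q N :=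
  ((LpN.equiv p N).trans (LpN.equiv q N).symm).toLinearMap

/-- The restriction of `J_{pq}^N` to `B(L_p^N)`. -/
def JBall (p q : ℝ≥0∞) [Fact (1 ≤ p)] (N : ℕ) : unitBall p N → LpN q N :=
  fun f => J p q N ((LpN.equiv p N).symm f.1)

end QIBC

end

/-! Consider functions with value `H = (N / (k + 1)) ^ (1 / p)` on at most `k + 1` points and `0`
elsewhere. They lie in the unit ball, and adding one point `v` to the support `t` moves the function
by `H` in the sup norm. An algorithm with error below `H / 2` thus tells every `k`-set `t` from
every `t ∪ {v}`.

The adversary method bounds the queries this takes. Sum the inner products of the two states over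
all pairs `(t, t ∪ {v})`. Each starts at `1` and must end at modulus at most `7 / 8`
(`norm_dotProduct_state_le`). Since the query mass of a state has total at most `1`, one query moves
the sum by at most `s * C(N, k) + s⁻¹ * C(N, k + 1)` (`isAdversary_spikes`). A suitable `s` gives
`(N - k) * (k + 1) ≤ 256 * n ^ 2`, which is violated once `k` is about `512 * n ^ 2 / N`.
Intermediate measurements are deferred: all parts run coherently on separate registers (`state`). -/

namespace QIBC

open Matrix

/-! ### Inner products under unitaries and basis permutations -/

lemma basisMap_mulVec {ι : Type*} [Fintype ι] [DecidableEq ι] (g : Equiv.Perm ι) (v : ι → ℂ) :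
    basisMap g *ᵥ v = v ∘ g.symm := by
  ext a
  simp [basisMap, mulVec, dotProduct, ← Equiv.symm_apply_eq]

lemma star_mulVec_dotProduct_mulVec {ι : Type*} [Fintype ι] [DecidableEq ι]
    (U : unitaryGroup ι ℂ) (u w : ι → ℂ) : star (U.1 *ᵥ u) ⬝ᵥ (U.1 *ᵥ w) = star u ⬝ᵥ w := by
  rw [star_mulVec, ← dotProduct_mulVec, mulVec_mulVec, ← star_eq_conjTranspose,
    mem_unitaryGroup_iff'.1 U.2, one_mulVec]

lemma star_dotProduct_self {ι : Type*} [Fintype ι] (u : ι → ℂ) :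
    star u ⬝ᵥ u = ((∑ a, ‖u a‖ ^ 2 : ℝ) : ℂ) := by
  simp [dotProduct, Complex.conj_mul']

lemma norm_mul_le_weighted (z w : ℂ) {s : ℝ} (hs : 0 < s) :
    ‖z‖ * ‖w‖ ≤ s / 2 * ‖z‖ ^ 2 + s⁻¹ / 2 * ‖w‖ ^ 2 := by
  have h : s / 2 * ‖z‖ ^ 2 + s⁻¹ / 2 * ‖w‖ ^ 2 - ‖z‖ * ‖w‖
      = s⁻¹ / 2 * (s * ‖z‖ - ‖w‖) ^ 2 := by
    field_simp
    ring
  have : 0 ≤ s⁻¹ / 2 * (s * ‖z‖ - ‖w‖) ^ 2 := by positivity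
  linarith

/-- Two permutations that agree outside an invariant set `S` change the inner product of two
vectors by no more than their components in `S` allow. -/
lemma norm_dotProduct_perm_sub_le {α : Type*} [Fintype α] (π ρ : Equiv.Perm α) (S : α → Prop)
    [DecidablePred S] (hπ : ∀ a, S (π a) ↔ S a) (hρ : ∀ a, S (ρ a) ↔ S a)
    (h : ∀ a, ¬ S a → π a = ρ a) (u w : α → ℂ) {s : ℝ} (hs : 0 < s) :
    ‖star (u ∘ π.symm) ⬝ᵥ (w ∘ ρ.symm) - star u ⬝ᵥ w‖ ≤
      s * (∑ a, if S a then ‖u a‖ ^ 2 else 0) + s⁻¹ * (∑ a, if S a then ‖w a‖ ^ 2 else 0) := by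
  -- Reindexing by `π` leaves a single permutation `σ` on the side of `w`, which fixes every point
  -- outside `S`.
  let σ : Equiv.Perm α := π.trans ρ.symm
  have hσ : ∀ a, S (σ a) ↔ S a := fun a => by
    rw [← hρ, ← hπ a]; simp [σ]
  have h1 : star (u ∘ π.symm) ⬝ᵥ (w ∘ ρ.symm) = ∑ a, star (u a) * w (σ a) := by
    rw [dotProduct, ← Equiv.sum_comp π]
    simp [σ]
  have h2 : (∑ a, if S a then ‖w (σ a)‖ ^ 2 else 0) = ∑ a, if S a then ‖w a‖ ^ 2 else 0 := by
    rw [← Equiv.sum_comp σ (fun a => if S a then ‖w a‖ ^ 2 else 0)]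
    simp [hσ]
  have h3 : ∀ a, ‖star (u a) * w (σ a) - star (u a) * w a‖ ≤
      s * (if S a then ‖u a‖ ^ 2 else 0) + s⁻¹ / 2 * (if S a then ‖w (σ a)‖ ^ 2 else 0)
        + s⁻¹ / 2 * (if S a then ‖w a‖ ^ 2 else 0) := by
    intro a
    by_cases ha : S a
    · simp only [ha, if_true]
      refine (norm_sub_le _ _).trans ?_
      rw [norm_mul, norm_mul, norm_star]
      linarith [norm_mul_le_weighted (u a) (w (σ a)) hs, norm_mul_le_weighted (u a) (w a) hs]
    · have : σ a = a := by simp [σ, h a ha]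
      simp [ha, this]
  rw [h1, dotProduct, ← Finset.sum_sub_distrib]
  refine (norm_sum_le_of_le _ fun a _ => h3 a).trans (le_of_eq ?_)
  rw [Finset.sum_add_distrib, Finset.sum_add_distrib, ← Finset.mul_sum, ← Finset.mul_sum,
    ← Finset.mul_sum, h2]
  ring

/-! ### The effect of one query -/

namespace Query

variable {D K : Type*} (Q : Query D K)

open Classical in
/-- The point at which the query evaluates `f` on the basis vector `a`, if there is one. -/
noncomputable def position (a : Fin (2 ^ Q.m)) : Option D :=
  if h : (Q.split.symm a).1 ∈ Q.Z then some (Q.τ ⟨_, h⟩) else none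

lemma position_perm (f : D → K) (a : Fin (2 ^ Q.m)) :
    Q.position (Q.perm f a) = Q.position a := by
  have h : (Q.split.symm (Q.perm f a)).1 = (Q.split.symm a).1 := by
    simp only [perm, Equiv.trans_apply, Equiv.symm_apply_apply]
    rfl
  unfold position
  rw [h]

lemma shift_congr {f g : D → K} (a : Fin (2 ^ Q.m))
    (h : ∀ v, Q.position a = some v → f v = g v) :
    Q.shift f (Q.split.symm a).1 = Q.shift g (Q.split.symm a).1 := by
  unfold shift
  split_ifs with ha
  · rw [h _ (by simp [position, ha])]
  · rfl

lemma perm_congr {f g : D → K} (a : Fin (2 ^ Q.m))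
    (h : ∀ v, Q.position a = some v → f v = g v) : Q.perm f a = Q.perm g a := by
  simp [perm, permTriple, Q.shift_congr a h]

open Classical in
/-- The squared norm of the part of `u` on which the query evaluates its input at `v`. -/
noncomputable def mass (u : Fin (2 ^ Q.m) → ℂ) (v : D) : ℝ :=
  ∑ a, if Q.position a = some v then ‖u a‖ ^ 2 else 0

lemma mass_nonneg (u : Fin (2 ^ Q.m) → ℂ) (v : D) : 0 ≤ Q.mass u v :=
  Finset.sum_nonneg fun a _ => by split_ifs <;> positivity

lemma sum_mass_le [Fintype D] (u : Fin (2 ^ Q.m) → ℂ) :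
    ∑ v, Q.mass u v ≤ ∑ a, ‖u a‖ ^ 2 := by
  classical
  unfold mass
  rw [Finset.sum_comm]
  refine Finset.sum_le_sum fun a _ => ?_
  rcases h : Q.position a with _ | v
  · simp
  · simp

/-- Both query permutations preserve the evaluated position and agree wherever it is not `v`, so
only amplitudes at position `v` matter. -/
lemma norm_op_sub_le {f g : D → K} {v : D} (h : ∀ v', v' ≠ v → f v' = g v')
    (u w : Fin (2 ^ Q.m) → ℂ) {s : ℝ} (hs : 0 < s) :
    ‖star ((Q.op f).1 *ᵥ u) ⬝ᵥ ((Q.op g).1 *ᵥ w) - star u ⬝ᵥ w‖ ≤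
      s * Q.mass u v + s⁻¹ * Q.mass w v := by
  classical
  have := norm_dotProduct_perm_sub_le (Q.perm f) (Q.perm g) (fun a => Q.position a = some v)
    (fun a => by rw [position_perm]) (fun a => by rw [position_perm])
    (fun a ha => Q.perm_congr a fun v' hv' => h v' (by rintro rfl; exact ha hv')) u w hs
  simp only [op, basisMap_mulVec, mass]
  convert this

end Query

/-! ### The adversary bound without measurements -/

/-- Pairs `(f i, g i)` of inputs that differ in one point only, such that a query can change the
sum of the inner products of the states at `f i` and at `g i` by no more than `B`. -/
structure IsAdversary {ι D K : Type*} [Fintype D] (R : Finset ι) (f g : ι → D → K) (v : ι → D)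
    (s B : ℝ) : Prop where
  pos : 0 < s
  agree : ∀ i ∈ R, ∀ v', v' ≠ v i → f i v' = g i v'
  sum_le : ∀ μ : (D → K) → D → ℝ, (∀ φ x, 0 ≤ μ φ x) → (∀ φ, ∑ x, μ φ x ≤ 1) →
    ∑ i ∈ R, (s * μ (f i) (v i) + s⁻¹ * μ (g i) (v i)) ≤ B

namespace PreAlgorithm

variable {D K : Type*} (A : PreAlgorithm D K)

/-- The operator `U_j Q_f U_{j-1} ⋯ U_1 Q_f U_0`. -/
noncomputable def partialOp (f : D → K) (j : Fin (A.n + 1)) : unitaryGroup (Fin (2 ^ A.Q.m)) ℂ :=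
  Fin.induction (motive := fun _ => unitaryGroup (Fin (2 ^ A.Q.m)) ℂ)
    (A.U 0) (fun j B => A.U j.succ * A.Q.op f * B) j

lemma partialOp_succ_mulVec (f : D → K) (j : Fin A.n) (u : Fin (2 ^ A.Q.m) → ℂ) :
    (A.partialOp f j.succ).1 *ᵥ u =
      (A.U j.succ).1 *ᵥ ((A.Q.op f).1 *ᵥ ((A.partialOp f j.castSucc).1 *ᵥ u)) := by
  rw [mulVec_mulVec, mulVec_mulVec]
  rfl

variable {ι β : Type*} [Fintype D] [Fintype β] {R : Finset ι} {f g : ι → D → K} {v : ι → D}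
  {s B : ℝ}

/-- The unitaries `U_j` preserve inner products, so only queries contribute, each at most `B`. The
index `r` stands for the registers of other parts, on which this part does not act. -/
lemma norm_partialOp_sub_le (h : IsAdversary R f g v s B)
    (ψ : (D → K) → β → Fin (2 ^ A.Q.m) → ℂ) (hψ : ∀ φ, ∑ r, ∑ a, ‖ψ φ r a‖ ^ 2 ≤ 1)
    (j : Fin (A.n + 1)) :
    ‖∑ i ∈ R, ∑ r, star ((A.partialOp (f i) j).1 *ᵥ ψ (f i) r) ⬝ᵥ
        ((A.partialOp (g i) j).1 *ᵥ ψ (g i) r) - ∑ i ∈ R, ∑ r, star (ψ (f i) r) ⬝ᵥ ψ (g i) r‖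
      ≤ (j : ℕ) * B := by
  induction j using Fin.induction with
  | zero =>
    have : ∀ φ, A.partialOp φ 0 = A.U 0 := fun _ => rfl
    simp [this, star_mulVec_dotProduct_mulVec]
  | succ j ih =>
    set χ : (D → K) → β → Fin (2 ^ A.Q.m) → ℂ :=
      fun φ r => (A.partialOp φ j.castSucc).1 *ᵥ ψ φ r with hχ
    have hnorm : ∀ φ, ∑ r, ∑ a, ‖χ φ r a‖ ^ 2 ≤ 1 := fun φ => by
      refine le_of_eq_of_le (Finset.sum_congr rfl fun r _ => ?_) (hψ φ)
      have := star_mulVec_dotProduct_mulVec (A.partialOp φ j.castSucc) (ψ φ r) (ψ φ r)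
      rw [star_dotProduct_self, star_dotProduct_self] at this
      exact_mod_cast this
    have hB := h.sum_le (fun φ x => ∑ r, A.Q.mass (χ φ r) x)
      (fun φ x => Finset.sum_nonneg fun r _ => A.Q.mass_nonneg _ _)
      (fun φ => by
        rw [Finset.sum_comm]
        exact (Finset.sum_le_sum fun r _ => A.Q.sum_mass_le _).trans (hnorm φ))
    have hstep : ‖∑ i ∈ R, ∑ r, star ((A.Q.op (f i)).1 *ᵥ χ (f i) r) ⬝ᵥ
        ((A.Q.op (g i)).1 *ᵥ χ (g i) r) - ∑ i ∈ R, ∑ r, star (χ (f i) r) ⬝ᵥ χ (g i) r‖ ≤ B := by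
      rw [← Finset.sum_sub_distrib]
      refine (norm_sum_le_of_le _ fun i hi => ?_).trans hB
      rw [← Finset.sum_sub_distrib, Finset.mul_sum, Finset.mul_sum, ← Finset.sum_add_distrib]
      exact norm_sum_le_of_le _ fun r _ => A.Q.norm_op_sub_le (h.agree i hi) _ _ h.pos
    simp only [partialOp_succ_mulVec, star_mulVec_dotProduct_mulVec]
    refine (norm_sub_le_norm_sub_add_norm_sub _ _ _).trans ((add_le_add hstep ih).trans ?_)
    simp only [Fin.val_castSucc, Fin.val_succ]
    push_cast
    linarith

lemma norm_op_sub_le (h : IsAdversary R f g v s B)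
    (ψ : (D → K) → β → Fin (2 ^ A.Q.m) → ℂ) (hψ : ∀ φ, ∑ r, ∑ a, ‖ψ φ r a‖ ^ 2 ≤ 1) :
    ‖∑ i ∈ R, ∑ r, star ((A.op (f i)).1 *ᵥ ψ (f i) r) ⬝ᵥ ((A.op (g i)).1 *ᵥ ψ (g i) r)
        - ∑ i ∈ R, ∑ r, star (ψ (f i) r) ⬝ᵥ ψ (g i) r‖ ≤ A.n * B :=
  A.norm_partialOp_sub_le h ψ hψ (Fin.last _)

end PreAlgorithm

/-! ### Deferred measurements -/

namespace Algorithm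

variable {D K G : Type*} (A : Algorithm D K G)

/-- The sequences of measurement outcomes. -/
abbrev Outcome : Type := (l : Fin A.k) → Fin (2 ^ (A.A l).Q.m)

/-- The contribution of the `l`-th part to `A.state f j`. -/
noncomputable def factor (f : D → K) (j : ℕ) (x : A.Outcome) (l : Fin A.k) : ℂ :=
  if (l : ℕ) < j then ((A.A l).op f).1 (x l) (A.b l fun i => x i) else if x l = 0 then 1 else 0

/-- The coherent state of all registers after the first `j` parts have been run. -/
noncomputable def state (f : D → K) (j : ℕ) (x : A.Outcome) : ℂ := ∏ l, A.factor f j x l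

/-- This justifies deferring measurements: measuring the coherent state once at the end reproduces
the outcome distribution. -/
lemma norm_state_sq (f : D → K) (x : A.Outcome) : ‖A.state f A.k x‖ ^ 2 = A.outcomeProb f x := by
  simp [state, factor, outcomeProb, Finset.prod_pow]

/-- The outcome sequence with entry `a` at `l` and the entries of `r` elsewhere. -/
def glue (l : Fin A.k) (a : Fin (2 ^ (A.A l).Q.m))
    (r : (i : {i : Fin A.k // i ≠ l}) → Fin (2 ^ (A.A i).Q.m)) : A.Outcome :=
  (Equiv.piSplitAt l fun i => Fin (2 ^ (A.A i).Q.m)).symm (a, r)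

variable {A} in
@[simp] lemma glue_self {l : Fin A.k} (a r) : A.glue l a r l = a := by
  simp [glue, Equiv.piSplitAt]

variable {A} in
lemma glue_of_ne {l i : Fin A.k} (h : i ≠ l) (a r) : A.glue l a r i = r ⟨i, h⟩ := by
  simp [glue, Equiv.piSplitAt, h]

lemma sum_eq_sum_glue (l : Fin A.k) {E : Type*} [AddCommMonoid E] (F : A.Outcome → E) :
    ∑ x, F x = ∑ r, ∑ a, F (A.glue l a r) := by
  rw [← Equiv.sum_comp (Equiv.piSplitAt l fun i => Fin (2 ^ (A.A i).Q.m)).symm F,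
    Fintype.sum_prod_type, Finset.sum_comm]
  rfl

/-- The initial basis state of the `l`-th part. -/
def start (l : Fin A.k) (r : (i : {i : Fin A.k // i ≠ l}) → Fin (2 ^ (A.A i).Q.m)) :
    Fin (2 ^ (A.A l).Q.m) :=
  A.b l fun i => r ⟨i, i.2.ne⟩

lemma b_glue (l : Fin A.k) (a r) : (A.b l fun i => A.glue l a r i) = A.start l r := by
  unfold start
  congr 1
  funext i
  exact glue_of_ne i.2.ne a r

/-- The contribution to `A.state f l` of all parts but the `l`-th. -/
noncomputable def rest (f : D → K) (l : Fin A.k)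
    (r : (i : {i : Fin A.k // i ≠ l}) → Fin (2 ^ (A.A i).Q.m)) : ℂ :=
  ∏ i ∈ Finset.univ.erase l, A.factor f l (A.glue l 0 r) i

lemma factor_glue (f : D → K) {l i : Fin A.k} (hi : i ≠ l) {j : ℕ} (hj : (i : ℕ) < j ↔ i < l)
    (a r) : A.factor f j (A.glue l a r) i = A.factor f l (A.glue l 0 r) i := by
  unfold factor
  by_cases h : i < l
  · have hb : (fun t : {t : Fin A.k // t < i} => A.glue l a r t)
        = fun t : {t : Fin A.k // t < i} => A.glue l 0 r t := by
      funext t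
      rw [glue_of_ne (t.2.trans h).ne, glue_of_ne (t.2.trans h).ne]
    rw [if_pos (hj.2 h), if_pos (by simpa using h), hb, glue_of_ne hi, glue_of_ne hi]
  · have h' : ¬ (i : ℕ) < l := h
    rw [if_neg (fun h' => h (hj.1 h')), if_neg h', glue_of_ne hi, glue_of_ne hi]

/-- The hypothesis covers `j = l` and `j = l + 1`. In both, the parts other than `l` that have been
run precede `l`, so their amplitudes do not see the entry `a`. -/
lemma state_glue (f : D → K) {l : Fin A.k} {j : ℕ} (hj : ∀ i ≠ l, (i : ℕ) < j ↔ i < l) (a r) :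
    A.state f j (A.glue l a r) = A.factor f j (A.glue l a r) l * A.rest f l r := by
  rw [state, ← Finset.mul_prod_erase _ _ (Finset.mem_univ l), rest]
  congr 1
  exact Finset.prod_congr rfl fun i hi =>
    A.factor_glue f (Finset.ne_of_mem_erase hi) (hj i (Finset.ne_of_mem_erase hi)) a r

/-- The state of the `l`-th register before the `l`-th part is run. -/
noncomputable def register (f : D → K) (l : Fin A.k)
    (r : (i : {i : Fin A.k // i ≠ l}) → Fin (2 ^ (A.A i).Q.m)) : Fin (2 ^ (A.A l).Q.m) → ℂ :=
  Pi.single (A.start l r) (A.rest f l r)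

/-- Moving the `l`-th register from `0` to `A.start l r` is harmless, since that basis state depends
on `r` but not on the input. -/
lemma dotProduct_state (f g : D → K) (l : Fin A.k) :
    star (A.state f l) ⬝ᵥ A.state g l
      = ∑ r, star (A.register f l r) ⬝ᵥ A.register g l r := by
  rw [dotProduct, A.sum_eq_sum_glue l]
  refine Finset.sum_congr rfl fun r _ => ?_
  have : ∀ φ a, A.state φ l (A.glue l a r) = (if a = 0 then 1 else 0) * A.rest φ l r := by
    intro φ a
    rw [A.state_glue φ (fun i _ => Iff.rfl)]
    simp [factor]
  simp [this, register, dotProduct_single]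

lemma dotProduct_state_succ (f g : D → K) (l : Fin A.k) :
    star (A.state f (l + 1)) ⬝ᵥ A.state g (l + 1)
      = ∑ r, star (((A.A l).op f).1 *ᵥ A.register f l r) ⬝ᵥ
          (((A.A l).op g).1 *ᵥ A.register g l r) := by
  rw [dotProduct, A.sum_eq_sum_glue l]
  refine Finset.sum_congr rfl fun r _ => Finset.sum_congr rfl fun a _ => ?_
  have : ∀ φ, A.state φ (l + 1) (A.glue l a r) = (((A.A l).op φ).1 *ᵥ A.register φ l r) a := by
    intro φ
    rw [A.state_glue φ (fun i hi => by
      rw [Nat.lt_succ_iff, Fin.val_fin_le]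
      exact ⟨fun h => lt_of_le_of_ne h hi, le_of_lt⟩)]
    simp [factor, register, b_glue, mulVec_single]
  simp [this]

lemma state_zero (f : D → K) : A.state f 0 = Pi.single 0 1 := by
  funext x
  simp only [state, factor, Nat.not_lt_zero, if_false, Finset.prod_ite_zero, Pi.single_apply,
    Finset.prod_const_one]
  simp [funext_iff]

lemma dotProduct_state_self (f : D → K) {j : ℕ} (hj : j ≤ A.k) :
    star (A.state f j) ⬝ᵥ A.state f j = 1 := by
  induction j with
  | zero => simp [state_zero]
  | succ j ih =>
    have h := A.dotProduct_state_succ f f ⟨j, hj⟩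
    simp only [star_mulVec_dotProduct_mulVec] at h
    rw [h, ← dotProduct_state]
    exact ih (by omega)

lemma sum_outcomeProb (f : D → K) : ∑ x, A.outcomeProb f x = 1 := by
  have := A.dotProduct_state_self f le_rfl
  rw [star_dotProduct_self] at this
  simp only [norm_state_sq] at this
  exact_mod_cast this

lemma outputProb_mono (f : D → K) {C C' : Set G} (h : C ⊆ C') :
    A.outputProb f C ≤ A.outputProb f C' := by
  refine Finset.sum_le_sum fun x _ => ?_
  have : 0 ≤ A.outcomeProb f x := Finset.prod_nonneg fun _ _ => by positivity
  split_ifs with h1 h2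
  · rfl
  · exact absurd (h h1) h2
  · exact this
  · rfl

lemma outputProb_compl (f : D → K) (C : Set G) :
    A.outputProb f Cᶜ = 1 - A.outputProb f C := by
  rw [eq_sub_iff_add_eq, ← A.sum_outcomeProb f, outputProb, outputProb, ← Finset.sum_add_distrib]
  refine Finset.sum_congr rfl fun x _ => ?_
  by_cases h : A.φ x ∈ C <;> simp [h]

/-- Inputs whose outputs are told apart with error probability `1 / 4` have final states that are
far from parallel. -/
lemma norm_dotProduct_state_le (f g : D → K) (C : Set G) (hf : A.outputProb f C ≤ 1 / 4)
    (hg : A.outputProb g Cᶜ ≤ 1 / 4) :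
    ‖star (A.state f A.k) ⬝ᵥ A.state g A.k‖ ≤ 7 / 8 := by
  classical
  -- Weight `1` on the unlikely side and `1 / 4` on the likely one: each input contributes at most
  -- `1 / 4 + 3 / 16 = 7 / 16`.
  have h1 : ∀ x, ‖star (A.state f A.k x) * A.state g A.k x‖ ≤
      (if A.φ x ∈ C then A.outcomeProb f x else 0) + (if A.φ x ∈ Cᶜ then A.outcomeProb f x else 0) / 4
      + ((if A.φ x ∈ C then A.outcomeProb g x else 0) / 4
      + (if A.φ x ∈ Cᶜ then A.outcomeProb g x else 0)) := by
    intro x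
    rw [norm_mul, norm_star, ← norm_state_sq, ← norm_state_sq]
    by_cases h : A.φ x ∈ C
    · have := norm_mul_le_weighted (A.state f A.k x) (A.state g A.k x) (show (0 : ℝ) < 2 by simp)
      norm_num at this
      simp [h]
      linarith
    · have := norm_mul_le_weighted (A.state f A.k x) (A.state g A.k x)
        (show (0 : ℝ) < 1 / 2 by norm_num)
      norm_num at this
      simp [h]
      linarith
  have h2 := norm_sum_le_of_le Finset.univ fun x _ => h1 x
  simp only [Finset.sum_add_distrib, ← Finset.sum_div] at h2
  have hf' := A.outputProb_compl f C
  have hg' := A.outputProb_compl g C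
  have e : ∀ φ S [DecidablePred (· ∈ S)],
      (∑ x, if A.φ x ∈ S then A.outcomeProb φ x else 0) = A.outputProb φ S :=
    fun _ _ _ => by unfold outputProb; congr!
  simp only [e] at h2
  refine h2.trans ?_
  linarith

variable {ι : Type*} [Fintype D] {R : Finset ι} {f g : ι → D → K} {v : ι → D} {s B : ℝ}

lemma norm_state_sub_le (h : IsAdversary R f g v s B) {j : ℕ} (hj : j ≤ A.k) :
    ‖∑ i ∈ R, star (A.state (f i) j) ⬝ᵥ A.state (g i) j - R.card‖
      ≤ (∑ l : Fin A.k, if (l : ℕ) < j then ((A.A l).n : ℝ) else 0) * B := by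
  induction j with
  | zero => simp [state_zero]
  | succ j ih =>
    let l : Fin A.k := ⟨j, hj⟩
    have hreg : ∀ φ, ∑ r, ∑ a, ‖A.register φ l r a‖ ^ 2 ≤ 1 := fun φ => by
      have h1 := A.dotProduct_state_self φ (show (l : ℕ) ≤ A.k by simp only [l]; omega)
      rw [dotProduct_state] at h1
      simp only [star_dotProduct_self] at h1
      exact le_of_eq (by exact_mod_cast h1)
    have h1 := (A.A l).norm_op_sub_le h (fun φ => A.register φ l) hreg
    simp only [← dotProduct_state, ← dotProduct_state_succ] at h1
    refine (norm_sub_le_norm_sub_add_norm_sub _ _ _).trans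
      ((add_le_add h1 (ih (by omega))).trans (le_of_eq ?_))
    rw [← add_mul]
    congr 1
    have : ∀ i : Fin A.k, (if (i : ℕ) < j + 1 then ((A.A i).n : ℝ) else 0)
        = (if i = l then ((A.A i).n : ℝ) else 0) + if (i : ℕ) < j then ((A.A i).n : ℝ) else 0 := by
      intro i
      by_cases hi : i = l
      · subst hi; simp [l]
      · have : (i : ℕ) ≠ j := fun h => hi (Fin.ext h)
        simp [hi, le_iff_lt_or_eq, this]
    simp only [this, Finset.sum_add_distrib]
    simp

/-- The lower bound on the number of queries of an algorithm that tells `f i` from `g i`. -/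
theorem card_le_of_isAdversary (h : IsAdversary R f g v s B)
    (C : ι → Set G) (hf : ∀ i ∈ R, A.outputProb (f i) (C i) ≤ 1 / 4)
    (hg : ∀ i ∈ R, A.outputProb (g i) (C i)ᶜ ≤ 1 / 4) :
    (R.card : ℝ) ≤ 8 * A.numQueries * B := by
  have h1 := A.norm_state_sub_le h le_rfl
  have h2 : ‖∑ i ∈ R, star (A.state (f i) A.k) ⬝ᵥ A.state (g i) A.k‖ ≤ ∑ i ∈ R, (7 / 8 : ℝ) :=
    norm_sum_le_of_le _ fun i hi => A.norm_dotProduct_state_le _ _ (C i) (hf i hi) (hg i hi)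
  have h3 := norm_sub_norm_le (R.card : ℂ) (∑ i ∈ R, star (A.state (f i) A.k) ⬝ᵥ A.state (g i) A.k)
  rw [norm_sub_rev] at h3
  simp only [Finset.sum_const, nsmul_eq_mul, Complex.norm_natCast, Fin.is_lt, if_true] at h1 h2 h3
  have h4 : (A.numQueries : ℝ) = ∑ l, ((A.A l).n : ℝ) := by simp [numQueries]
  rw [h4]
  linarith

end Algorithm

end QIBC

namespace QIBC

/-! ### Spike functions and the count of pairs -/

/-- The function with value `h` on `t` and `0` elsewhere. -/
noncomputable def spikes {D : Type*} [DecidableEq D] (h : ℝ) (t : Finset D) (x : D) : ℝ :=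
  if x ∈ t then h else 0

/-- The `k`-element sets, each with a point outside it. -/
def extensions (D : Type*) [Fintype D] [DecidableEq D] (k : ℕ) :
    Finset (Σ _ : Finset D, D) :=
  (Finset.powersetCard k Finset.univ).sigma fun t => tᶜ

section Extensions

variable {D : Type*} [Fintype D] [DecidableEq D]

lemma mem_extensions {k : ℕ} {i : Σ _ : Finset D, D} :
    i ∈ extensions D k ↔ i.1.card = k ∧ i.2 ∉ i.1 := by
  simp [extensions]

lemma card_extensions (k : ℕ) :
    (extensions D k).card = (Fintype.card D).choose k * (Fintype.card D - k) := by
  rw [extensions, Finset.card_sigma,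
    Finset.sum_congr rfl (g := fun _ => Fintype.card D - k) fun t ht => by
      rw [Finset.card_compl, (Finset.mem_powersetCard.1 ht).2]]
  simp

/-- Adding the outside point is a bijection onto the `k + 1`-sets with a marked element. -/
lemma sum_extensions_insert (k : ℕ) (F : Finset D → D → ℝ) :
    ∑ i ∈ extensions D k, F (insert i.2 i.1) i.2
      = ∑ t ∈ Finset.powersetCard (k + 1) Finset.univ, ∑ v ∈ t, F t v := by
  rw [Finset.sum_sigma' (Finset.powersetCard (k + 1) Finset.univ) (fun t => t)]
  refine Finset.sum_nbij' (fun i => ⟨insert i.2 i.1, i.2⟩) (fun i => ⟨i.1.erase i.2, i.2⟩)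
    ?_ ?_ ?_ ?_ ?_
  · rintro ⟨t, v⟩ hi
    obtain ⟨h1, h2⟩ := mem_extensions.1 hi
    simp_all
  · rintro ⟨t, v⟩ hi
    rw [Finset.mem_sigma, Finset.mem_powersetCard] at hi
    rw [mem_extensions]
    simp_all [Finset.card_erase_of_mem]
  · rintro ⟨t, v⟩ hi
    simp [Finset.erase_insert (mem_extensions.1 hi).2]
  · rintro ⟨t, v⟩ hi
    rw [Finset.mem_sigma] at hi
    simp [Finset.insert_erase hi.2]
  · intro i _
    rfl

/-- The pairs containing a given set have distinct points `v`, so their masses add up to at most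
`1`; it remains to count the sets on each side. -/
lemma isAdversary_spikes (h : ℝ) (k : ℕ) {s : ℝ} (hs : 0 < s) :
    IsAdversary (extensions D k) (fun i => spikes h i.1) (fun i => spikes h (insert i.2 i.1))
      (fun i => i.2) s
      (s * (Fintype.card D).choose k + s⁻¹ * (Fintype.card D).choose (k + 1)) where
  pos := hs
  agree i _ v' hv := by simp [spikes, hv]
  sum_le μ h0 h1 := by
    have hle : ∀ (φ : D → ℝ) (t : Finset D), ∑ v ∈ t, μ φ v ≤ 1 := fun φ t =>
      (Finset.sum_le_univ_sum_of_nonneg (h0 φ)).trans (h1 φ)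
    have ha : ∑ i ∈ extensions D k, μ (spikes h i.1) i.2 ≤ (Fintype.card D).choose k := by
      rw [extensions, Finset.sum_sigma]
      refine (Finset.sum_le_sum fun t _ => hle (spikes h t) tᶜ).trans ?_
      simp
    have hb : ∑ i ∈ extensions D k, μ (spikes h (insert i.2 i.1)) i.2
        ≤ (Fintype.card D).choose (k + 1) := by
      rw [sum_extensions_insert k fun t v => μ (spikes h t) v]
      refine (Finset.sum_le_sum fun t _ => hle (spikes h t) t).trans ?_
      simp
    rw [Finset.sum_add_distrib, ← Finset.mul_sum, ← Finset.mul_sum]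
    gcongr

end Extensions

/-- Telling all `k`-element sets from the `k + 1`-element sets that contain them takes at least
`√((N - k) (k + 1)) / 16` queries. -/
lemma Algorithm.le_numQueries_of_spikes {N k : ℕ} {G : Type*} (A : Algorithm (Fin N) ℝ G)
    (hk : k < N) (h : ℝ) (C : (Σ _ : Finset (Fin N), Fin N) → Set G)
    (hf : ∀ i ∈ extensions (Fin N) k, A.outputProb (spikes h i.1) (C i) ≤ 1 / 4)
    (hg : ∀ i ∈ extensions (Fin N) k, A.outputProb (spikes h (insert i.2 i.1)) (C i)ᶜ ≤ 1 / 4)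
    {n : ℕ} (hn : 0 < n) (hA : A.numQueries ≤ n) :
    ((N : ℝ) - k) * (k + 1) ≤ 256 * (n : ℝ) ^ 2 := by
  have hNk : (0 : ℝ) < (N : ℝ) - k := sub_pos.2 (by exact_mod_cast hk)
  have hn' : (0 : ℝ) < n := by exact_mod_cast hn
  have hA' : (A.numQueries : ℝ) ≤ n := by exact_mod_cast hA
  -- With this `s`, the first term of the adversary bound uses up exactly half of the number of
  -- pairs.
  have hs : 0 < ((N : ℝ) - k) / (16 * n) := by positivity
  have h1 := A.card_le_of_isAdversary (isAdversary_spikes h k hs) C hf hg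
  rw [card_extensions, Fintype.card_fin] at h1
  have hch : (N.choose (k + 1) : ℝ) * (k + 1) = N.choose k * ((N : ℝ) - k) := by
    have := Nat.choose_succ_right_eq N k
    rw [← Nat.cast_sub hk.le]
    exact_mod_cast this
  have hpos : (0 : ℝ) < N.choose k := by exact_mod_cast Nat.choose_pos hk.le
  have hsucc : (N.choose (k + 1) : ℝ) = N.choose k * ((N : ℝ) - k) / (k + 1) := by
    rw [← hch]; field_simp
  push_cast [Nat.cast_sub hk.le] at h1
  rw [hsucc] at h1
  have h2 := h1.trans (mul_le_mul_of_nonneg_right (mul_le_mul_of_nonneg_left hA' (by norm_num))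
    (by positivity))
  have h3 : 8 * (n : ℝ) * (((N : ℝ) - k) / (16 * n) * N.choose k
      + (((N : ℝ) - k) / (16 * n))⁻¹ * (N.choose k * ((N : ℝ) - k) / (k + 1)))
      = N.choose k * (((N : ℝ) - k) / 2 + 128 * n ^ 2 / (k + 1)) := by
    field_simp
    ring
  rw [h3, mul_le_mul_iff_right₀ hpos] at h2
  have h4 : ((N : ℝ) - k) / 2 ≤ 128 * n ^ 2 / (k + 1) := by linarith
  rw [le_div_iff₀ (by positivity)] at h4
  linarith

/-! ### From small error to distinguishing spikes -/

lemma abs_apply_le_norm {N : ℕ} (u : LpN ∞ N) (i : Fin N) : |LpN.equiv ∞ N u i| ≤ ‖u‖ := by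
  rw [LpN.norm_def, LpN.lpNorm, if_pos rfl]
  exact le_ciSup (f := fun i => |LpN.equiv ∞ N u i|) (Set.finite_range _).bddAbove i

variable {p : ℝ≥0∞} [Fact (1 ≤ p)]

/-- For finite `p` the `p`-th power of the norm is `t.card / K`. For `p = ∞` the exponent is `0` and
the height is `1`. -/
lemma spikes_mem_unitBall {N K : ℕ} (hN : 0 < N) (hK : 0 < K) {t : Finset (Fin N)}
    (ht : t.card ≤ K) : spikes (((N : ℝ) / K) ^ (1 / p).toReal) t ∈ unitBall p N := by
  change LpN.lpNorm p (spikes (((N : ℝ) / K) ^ (1 / p).toReal) t) ≤ 1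
  by_cases hp : p = ∞
  · subst hp
    rw [LpN.lpNorm, if_pos rfl]
    refine Real.iSup_le (fun i => ?_) zero_le_one
    unfold spikes
    split_ifs <;> simp
  · have h1 : (1 : ℝ≥0∞) ≤ p := Fact.out
    have hpos : 0 < p.toReal := ENNReal.toReal_pos (by rintro rfl; simp at h1) hp
    have hN' : (0 : ℝ) < N := by exact_mod_cast hN
    have hK' : (0 : ℝ) < K := by exact_mod_cast hK
    have ht' : (t.card : ℝ) ≤ K := by exact_mod_cast ht
    have hsum : ∑ i, |spikes (((N : ℝ) / K) ^ (1 / p).toReal) t i| ^ p.toReal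
        = t.card * (N / K) := by
      have : ∀ i, |spikes (((N : ℝ) / K) ^ (1 / p).toReal) t i| ^ p.toReal
          = if i ∈ t then (N / K : ℝ) else 0 := by
        intro i
        unfold spikes
        split_ifs
        · rw [abs_of_nonneg (by positivity), ← Real.rpow_mul (by positivity), ENNReal.toReal_div,
            ENNReal.toReal_one, one_div_mul_cancel hpos.ne', Real.rpow_one]
        · simp [hpos.ne']
      simp only [this]
      simp
    rw [LpN.lpNorm, if_neg hp, hsum]
    refine Real.rpow_le_one (by positivity) ?_ (by positivity)
    rw [show 1 / (N : ℝ) * (t.card * (N / K)) = t.card / K by field_simp]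
    exact (div_le_one hK').2 ht'

lemma outputProb_le_of_errorOn_lt {D K G : Type*} [NormedAddCommGroup G] {F : Set (D → K)}
    {S : F → G} {A : Algorithm D K G} {θ ε : ℝ} (h : errorOn S A θ < ENNReal.ofReal ε) (f : F) :
    A.outputProb f {g | ε ≤ ‖S f - g‖} ≤ θ := by
  have h1 : errorAt S A f θ < ENNReal.ofReal ε := (le_iSup (errorAt S A · θ) f).trans_lt h
  simp only [errorAt, iInf_lt_iff] at h1
  obtain ⟨δ, hδ, hlt⟩ := h1
  have hlt' : (δ : ℝ) < ε := by
    rw [ENNReal.ofReal, ENNReal.coe_lt_coe] at hlt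
    exact Real.lt_toNNReal_iff_coe_lt.1 hlt
  exact (A.outputProb_mono _ fun g hg => hlt'.trans_le hg).trans hδ

lemma ofReal_le_minError {n N k : ℕ} (hn : 0 < n) (hk : k < N)
    (h : 256 * (n : ℝ) ^ 2 < ((N : ℝ) - k) * (k + 1)) {ε : ℝ}
    (hε : 2 * ε ≤ ((N : ℝ) / (k + 1 : ℕ)) ^ (1 / p).toReal) :
    ENNReal.ofReal ε ≤ minError n (JBall p ∞ N) := by
  by_contra! hlt
  simp only [minError, minErrorWith, iInf_lt_iff] at hlt
  obtain ⟨A, hA, hlt⟩ := hlt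
  have hball : ∀ t : Finset (Fin N), t.card ≤ k + 1 →
      spikes (((N : ℝ) / (k + 1 : ℕ)) ^ (1 / p).toReal) t ∈ unitBall p N :=
    fun t ht => spikes_mem_unitBall (by omega) (by omega) ht
  set H := ((N : ℝ) / (k + 1 : ℕ)) ^ (1 / p).toReal with hH
  let S : (Fin N → ℝ) → LpN ∞ N := (LpN.equiv ∞ N).symm
  -- An output closer than `ε` to the smaller spike function is at distance at least `H - ε ≥ ε`
  -- from the larger one.
  refine h.not_ge (A.le_numQueries_of_spikes hk H (fun i => {g | ε ≤ ‖S (spikes H i.1) - g‖})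
    (fun i hi => ?_) (fun i hi => ?_) hn hA)
  · exact outputProb_le_of_errorOn_lt hlt ⟨_, hball i.1 (by have := mem_extensions.1 hi; omega)⟩
  · obtain ⟨h1, h2⟩ := mem_extensions.1 hi
    refine (A.outputProb_mono _ fun g hg => ?_).trans (outputProb_le_of_errorOn_lt hlt
      ⟨_, hball (insert i.2 i.1) (by rw [Finset.card_insert_of_notMem h2, h1])⟩)
    have hg' : ‖S (spikes H i.1) - g‖ < ε := not_le.1 hg
    change ε ≤ ‖S (spikes H (insert i.2 i.1)) - g‖
    have h3 : H ≤ ‖S (spikes H (insert i.2 i.1)) - S (spikes H i.1)‖ := by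
      refine le_trans ?_ (abs_apply_le_norm _ i.2)
      have : LpN.equiv ∞ N (S (spikes H (insert i.2 i.1)) - S (spikes H i.1)) i.2 = H := by
        simp [S, spikes, h2]
      rw [this]
      exact le_abs_self H
    have h4 := norm_sub_le_norm_sub_add_norm_sub (S (spikes H (insert i.2 i.1))) g
      (S (spikes H i.1))
    rw [norm_sub_rev g] at h4
    linarith

end QIBC

/-! ### Choice of `k` and of the constants -/

theorem proposition3 (p : ℝ≥0∞) [Fact (1 ≤ p)] :
    ∃ c₁ : ℝ, 0 < c₁ ∧ ∃ c₂ : ℝ, 0 < c₂ ∧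
      ∀ n N : ℕ, 1 ≤ n → 1 ≤ N → (n : ℝ) ≤ c₁ * N →
        ENNReal.ofReal
            (c₂ * min (((N : ℝ) / (n : ℝ)) ^ (2 / p).toReal) ((N : ℝ) ^ (1 / p).toReal)) ≤
          QIBC.minError n (QIBC.JBall p ∞ N) := by
  refine ⟨1 / 64, by norm_num, 1 / 1026, by norm_num, fun n N hn hN hnN => ?_⟩
  have hn' : (1 : ℝ) ≤ n := by exact_mod_cast hn
  have hN' : (64 : ℝ) ≤ N := by linarith
  have hNpos : (0 : ℝ) < N := by linarith
  -- With `k = ⌊q⌋₊`, the bound `n ≤ N / 64` gives `k ≤ N / 8`, so `(N - k) * (k + 1)` exceeds `7 /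
  -- 8 * 512 * n ^ 2 > 256 * n ^ 2`.
  set q : ℝ := 512 * (n : ℝ) ^ 2 / N with hq
  have hq0 : 0 ≤ q := by positivity
  have hqN : q * N = 512 * (n : ℝ) ^ 2 := by rw [hq]; field_simp
  have hq8 : q ≤ N / 8 := by
    rw [hq, div_le_iff₀ hNpos]
    nlinarith
  have hk1 : (⌊q⌋₊ : ℝ) ≤ q := Nat.floor_le hq0
  have hk2 : q < ⌊q⌋₊ + 1 := Nat.lt_floor_add_one q
  have hkN : ⌊q⌋₊ < N := by
    have : (⌊q⌋₊ : ℝ) < N := by linarith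
    exact_mod_cast this
  refine QIBC.ofReal_le_minError (k := ⌊q⌋₊) hn hkN ?_ ?_
  · nlinarith
  · have h1 : (1 : ℝ≥0∞) ≤ p := Fact.out
    have hp0 : 0 ≤ (1 / p).toReal := ENNReal.toReal_nonneg
    have hp1 : (1 / p).toReal ≤ 1 := by
      rw [← ENNReal.toReal_one]
      exact ENNReal.toReal_mono ENNReal.one_ne_top (by simpa using h1)
    have h2 : (2 / p).toReal = 2 * (1 / p).toReal := by
      simp [div_eq_mul_inv]
    -- As `1 / p ≤ 1`, the factor `1 / 513` survives the power, so the constants do not depend on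
    -- `p`.
    have hmul : (1 / 513 : ℝ) ≤ (1 / 513 : ℝ) ^ (1 / p).toReal := by
      have := Real.rpow_le_rpow_of_exponent_ge (x := (1 / 513 : ℝ)) (by norm_num) (by norm_num) hp1
      simpa using this
    -- `513 = 512 + 1`: the minimum times `q` is at most `512 * N`, and the minimum itself is at
    -- most `N`.
    have hkey : 1 / 513 * min (((N : ℝ) / n) ^ 2) N ≤ (N : ℝ) / (⌊q⌋₊ + 1 : ℕ) := by
      push_cast
      rw [le_div_iff₀ (by positivity)]
      have hM1 : min (((N : ℝ) / n) ^ 2) N ≤ N := min_le_right _ _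
      have hM2 : min (((N : ℝ) / n) ^ 2) N * q ≤ 512 * N := by
        refine (mul_le_mul_of_nonneg_right (min_le_left _ _) hq0).trans (le_of_eq ?_)
        rw [hq]; field_simp
      have hM0 : 0 ≤ min (((N : ℝ) / n) ^ 2) N := by positivity
      nlinarith [mul_le_mul_of_nonneg_left hk1 hM0]
    have hmin : min (((N : ℝ) / n) ^ (2 / p).toReal) ((N : ℝ) ^ (1 / p).toReal)
        = (min (((N : ℝ) / n) ^ 2) N) ^ (1 / p).toReal := by
      rw [h2, Real.rpow_mul (by positivity), Real.rpow_two]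
      rcases le_total (((N : ℝ) / n) ^ 2) N with h | h
      · rw [min_eq_left h, min_eq_left (Real.rpow_le_rpow (by positivity) h hp0)]
      · rw [min_eq_right h, min_eq_right (Real.rpow_le_rpow (by positivity) h hp0)]
    rw [hmin]
    have hM0 : 0 ≤ min (((N : ℝ) / n) ^ 2) (N : ℝ) := by positivity
    calc 2 * (1 / 1026 * (min (((N : ℝ) / n) ^ 2) N) ^ (1 / p).toReal)
        = 1 / 513 * (min (((N : ℝ) / n) ^ 2) N) ^ (1 / p).toReal := by ring
      _ ≤ (1 / 513) ^ (1 / p).toReal * (min (((N : ℝ) / n) ^ 2) N) ^ (1 / p).toReal := by gcongr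
      _ = (1 / 513 * min (((N : ℝ) / n) ^ 2) N) ^ (1 / p).toReal :=
          (Real.mul_rpow (by norm_num) hM0).symm
      _ ≤ _ := Real.rpow_le_rpow (by positivity) hkey hp0
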